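/- Let $\mathbb K=\mathbb R$ or $\mathbb C$, let $\lambda=(\lambda_1,\dots,\lambda_n)\in\mathbb K^n$, let $S=\sum_{j=1}^n\lambda_jx_j\frac{\partial}{\partial x_j}$, and write $(Q,\lambda)=\sum_{i=1}^n q_i\lambda_i$ and $|Q|=q_1+\dots+q_n$ for $Q=(q_1,\dots,q_n)\in\mathbb N^n$. A formal power series $f=\sum_{Q\in\mathbb N^n}f_Qx^Q$ over $\mathbb K$ is called $\alpha$-Gevrey if there are constants $M,C>0$ such that $|f_Q|\le M\,C^{|Q|}(|Q|!)^{\alpha}$ for all $Q\in\mathbb N^n$. (1) Let $\alpha>0$ and suppose that there is a constant $C>0$, independent of $Q$ and $j$, such that $$|\lambda_j-(Q,\lambda)|\ \ge\ C\,|Q|^{1-\alpha},\qquad j=1,\dots,n,\quad\text{for all sufficiently large }|Q|.$$ Then the Poincaré–Dulac normal form holds in the $\alpha$-Gevrey category: for every germ $R$ at $0\in\mathbb K^n$ of an analytic map $\mathbb K^n\to\mathbb K^n$ with $R(0)=0$ and $DR(0)=0$, there are $n$-tuples $F,N$ of formal power series of order at least $2$ such that every component of $F$ is $\alpha$-Gevrey,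 $N$ is resonant, i.e. it contains only monomials $x^Q\frac{\partial}{\partial x_j}$ with $\lambda_j=(Q,\lambda)$, and the formal transformation $\mathrm{id}+F$ conjugates $S+R$ to the formal normal form $S+N$: $$\bigl(I+DF(x)\bigr)^{-1}\,(S+R)\bigl(x+F(x)\bigr)=(S+N)(x).$$ (2) In particular, if $\tau>0$ and $\lambda$ satisfies the Siegel condition of type $\tau$, i.e. there is a constant $C>0$ such that $0\ne|(Q,\lambda)-\lambda_j|\ge C|Q|^{-\tau}$ for all $Q\in\mathbb N^n$ with $|Q|\ge2$ and all $j=1,\dots,n$, then the conclusion of (1) holds with $\alpha=1+\tau$. -/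

import Mathlib

/-- The Taylor series at the origin of a function of `n` variables: the coefficient of `x^Q` is
`∂^Q f (0) / Q!`, where `∂^Q f (0)` is the `|Q|`-th derivative of `f` at `0` evaluated on the list
of basis vectors in which `e_i` occurs `q_i` times. -/
noncomputable def taylorAtZero {𝕜 : Type*} [RCLike 𝕜] {n : ℕ}
    (f : (Fin n → 𝕜) → 𝕜) : MvPowerSeries (Fin n) 𝕜 :=
  fun Q =>
    iteratedFDeriv 𝕜 (∑ i, Q i) f 0
        (fun k => Pi.single (finSigmaFinEquiv.symm k).1 (1 : 𝕜))
      / ((∏ i, (Q i).factorial : ℕ) : 𝕜)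

/-- The number `(Q, λ) = ∑ q_i λ_i`. -/
def weightedSum {𝕜 : Type*} [RCLike 𝕜] {n : ℕ} (lam : Fin n → 𝕜) (Q : Fin n →₀ ℕ) : 𝕜 :=
  ∑ i, (Q i : 𝕜) * lam i

/-- The diagonal linear vector field `S = ∑ λ_j x_j ∂/∂x_j`, as a tuple of power series. -/
noncomputable def diagonalField {𝕜 : Type*} [RCLike 𝕜] {n : ℕ} (lam : Fin n → 𝕜) :
    Fin n → MvPowerSeries (Fin n) 𝕜 :=
  fun j => MvPowerSeries.C (lam j) * MvPowerSeries.X j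

/-- A power series is `α`-Gevrey if `|f_Q| ≤ M C^|Q| (|Q|!)^α` for all `Q`. -/
def IsGevrey {𝕜 : Type*} [RCLike 𝕜] {n : ℕ} (α : ℝ) (f : MvPowerSeries (Fin n) 𝕜) : Prop :=
  ∃ M C : ℝ, 0 < M ∧ 0 < C ∧ ∀ Q : Fin n →₀ ℕ,
    ‖MvPowerSeries.coeff Q f‖ ≤ M * C ^ Q.degree * (Q.degree.factorial : ℝ) ^ α

/-- A tuple of power series without terms of degree `0` and `1`. -/
def HasOrderGETwo {𝕜 : Type*} [RCLike 𝕜] {n : ℕ}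
    (F : Fin n → MvPowerSeries (Fin n) 𝕜) : Prop :=
  ∀ (j : Fin n) (Q : Fin n →₀ ℕ), Q.degree ≤ 1 → MvPowerSeries.coeff Q (F j) = 0

/-- A formal vector field all of whose monomials `x^Q ∂/∂x_j` are resonant: `λ_j = (Q, λ)`. -/
def IsResonant {𝕜 : Type*} [RCLike 𝕜] {n : ℕ} (lam : Fin n → 𝕜)
    (N : Fin n → MvPowerSeries (Fin n) 𝕜) : Prop :=
  ∀ (j : Fin n) (Q : Fin n →₀ ℕ), MvPowerSeries.coeff Q (N j) ≠ 0 → lam j = weightedSum lam Q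

/-- The formal transformation `Φ = id + F` conjugates the formal vector field `V` to `W`:
`(I + DF(x)) W(x) = V(x + F(x))`, that is, `W = (I + DF)⁻¹ (V ∘ (id + F))`.
It is used for `F` of order at least two only; then `I + DF` is invertible and the substitution
of `id + F` into a power series is well defined. -/
def Conjugates {𝕜 : Type*} [RCLike 𝕜] {n : ℕ}
    (F V W : Fin n → MvPowerSeries (Fin n) 𝕜) : Prop :=
  ∀ j : Fin n, W j + ∑ k, MvPowerSeries.pderiv 𝕜 k (F j) * W k
    = MvPowerSeries.subst (fun i => MvPowerSeries.X i + F i) (V j)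

/-- The bound `|λ_j - (Q, λ)| ≥ C |Q|^(1 - α)` for all `j` and all `Q` with `|Q|` large. -/
def RelativeDenominatorBound {𝕜 : Type*} [RCLike 𝕜] {n : ℕ}
    (lam : Fin n → 𝕜) (α : ℝ) : Prop :=
  ∃ C : ℝ, 0 < C ∧ ∃ K : ℕ, ∀ Q : Fin n →₀ ℕ, K ≤ Q.degree → ∀ j : Fin n,
    C * (Q.degree : ℝ) ^ (1 - α) ≤ ‖lam j - weightedSum lam Q‖

/-- The Siegel condition of type `τ`. -/
def SiegelCondition {𝕜 : Type*} [RCLike 𝕜] {n : ℕ} (lam : Fin n → 𝕜) (τ : ℝ) : Prop :=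
  ∃ C : ℝ, 0 < C ∧ ∀ Q : Fin n →₀ ℕ, 2 ≤ Q.degree → ∀ j : Fin n,
    ‖weightedSum lam Q - lam j‖ ≠ 0 ∧
      C / (Q.degree : ℝ) ^ τ ≤ ‖weightedSum lam Q - lam j‖

/-- The Poincaré–Dulac normal form with linear part `S = diag(λ)` holds in the `α`-Gevrey
category: for every germ `R` at the origin of an analytic map of order at least two, `S + R` is
conjugate to `S + N`, with `N` resonant of order at least two, by a formal transformation `id + F`
with `F` of order at least two and `α`-Gevrey. -/
def PoincareDulacHoldsInGevrey {𝕜 : Type*} [RCLike 𝕜] {n : ℕ}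
    (lam : Fin n → 𝕜) (α : ℝ) : Prop :=
  ∀ R : (Fin n → 𝕜) → (Fin n → 𝕜), AnalyticAt 𝕜 R 0 → R 0 = 0 → fderiv 𝕜 R 0 = 0 →
    ∃ F N : Fin n → MvPowerSeries (Fin n) 𝕜,
      HasOrderGETwo F ∧ (∀ j, IsGevrey α (F j)) ∧
      HasOrderGETwo N ∧ IsResonant lam N ∧
      Conjugates F
        (fun j => diagonalField lam j + taylorAtZero (fun x => R x j))
        (fun j => diagonalField lam j + N j)

/-! Comparing coefficients of `x^Q`, the conjugacy equation reads `((Q, λ) - λ_j) F_Q + N_Q = G_Q`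
with `G = R(x + F) - DF · N`. Since `R`, `F`, `N` have order at least two, `G_Q` involves only
coefficients of degree below `|Q|`, so the equation is solved recursively: resonant coefficients go
to `N`, the others to `F`. The denominator bound excludes resonances of large degree, so `N` is a
polynomial.

The Gevrey estimate uses the `ℓ¹` norm with weights `w_k = t^k / (k!)^α`. Division by the
denominator costs at most a factor of order `k^(α-1)` in degree `k`. This is repaid by
`rpow_mul_gevreyWeight_add_le`: a product of two series without constant term gains `k^α`, because
`(i + j) i! j! ≤ (i + j)!` for `i, j ≥ 1`. In `R(x + F)` the gain is more than needed; in `DF · N`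
the derivative consumes one factor `k`, leaving exactly `k^(α-1)`.

Every contribution is thus quadratically small: if the part of `F` of degree at most `m - 1` has
norm at most `t`, the part of degree at most `m` has norm at most `L t²`, with `L` independent of
`m` and `t`. Choosing `t` with `L t ≤ 1` closes the induction (`exists_weightedNorm_le`). -/

/-! ### Truncated weighted norms -/

/-- The finite set of multi-indices of degree at most `m`. -/
noncomputable def degreeLE (n m : ℕ) : Finset (Fin n →₀ ℕ) :=
  (Finsupp.finite_of_degree_le (σ := Fin n) m).toFinset

theorem mem_degreeLE {n m : ℕ} {Q : Fin n →₀ ℕ} : Q ∈ degreeLE n m ↔ Q.degree ≤ m := by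
  simp [degreeLE]

/-- The weighted `ℓ¹` norm of the part of degree at most `m` of a power series. -/
noncomputable def weightedNorm {𝕜 : Type*} [RCLike 𝕜] {n : ℕ} (v : ℕ → ℝ) (m : ℕ)
    (f : MvPowerSeries (Fin n) 𝕜) : ℝ :=
  ∑ Q ∈ degreeLE n m, v Q.degree * ‖MvPowerSeries.coeff Q f‖

theorem weightedNorm_nonneg {𝕜 : Type*} [RCLike 𝕜] {n : ℕ} {v : ℕ → ℝ} (hv : ∀ k, 0 ≤ v k)
    (m : ℕ) (f : MvPowerSeries (Fin n) 𝕜) : 0 ≤ weightedNorm v m f :=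
  Finset.sum_nonneg fun _ _ => mul_nonneg (hv _) (norm_nonneg _)

theorem weightedNorm_add_le {𝕜 : Type*} [RCLike 𝕜] {n : ℕ} {v : ℕ → ℝ} (hv : ∀ k, 0 ≤ v k)
    (m : ℕ) (f g : MvPowerSeries (Fin n) 𝕜) :
    weightedNorm v m (f + g) ≤ weightedNorm v m f + weightedNorm v m g := by
  unfold weightedNorm
  rw [← Finset.sum_add_distrib]
  refine Finset.sum_le_sum fun Q _ => ?_
  rw [map_add, ← mul_add]
  exact mul_le_mul_of_nonneg_left (norm_add_le _ _) (hv _)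

theorem weightedNorm_neg {𝕜 : Type*} [RCLike 𝕜] {n : ℕ} (v : ℕ → ℝ)
    (m : ℕ) (f : MvPowerSeries (Fin n) 𝕜) : weightedNorm v m (-f) = weightedNorm v m f := by
  simp [weightedNorm]

theorem weightedNorm_sum_le {𝕜 : Type*} [RCLike 𝕜] {n : ℕ} {v : ℕ → ℝ} (hv : ∀ k, 0 ≤ v k)
    (m : ℕ) {ι : Type*} (s : Finset ι) (f : ι → MvPowerSeries (Fin n) 𝕜) :
    weightedNorm v m (∑ i ∈ s, f i) ≤ ∑ i ∈ s, weightedNorm v m (f i) := by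
  classical
  induction s using Finset.induction_on with
  | empty => simp [weightedNorm]
  | insert a s ha ih =>
    rw [Finset.sum_insert ha, Finset.sum_insert ha]
    exact (weightedNorm_add_le hv m _ _).trans (by gcongr)

theorem weightedNorm_one {𝕜 : Type*} [RCLike 𝕜] {n : ℕ} (v : ℕ → ℝ) (m : ℕ) :
    weightedNorm v m (1 : MvPowerSeries (Fin n) 𝕜) = v 0 := by
  classical
  unfold weightedNorm
  rw [Finset.sum_eq_single (0 : Fin n →₀ ℕ)]
  · simp
  · intro Q _ hQ
    simp [MvPowerSeries.coeff_one, hQ]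
  · intro h
    exact absurd (mem_degreeLE.2 (by simp)) h

theorem weightedNorm_X_le {𝕜 : Type*} [RCLike 𝕜] {n : ℕ} {v : ℕ → ℝ} (hv : ∀ k, 0 ≤ v k)
    (m : ℕ) (i : Fin n) :
    weightedNorm v m (MvPowerSeries.X i : MvPowerSeries (Fin n) 𝕜) ≤ v 1 := by
  classical
  calc weightedNorm v m (MvPowerSeries.X i : MvPowerSeries (Fin n) 𝕜)
      ≤ ∑ Q ∈ degreeLE n m, if Q = Finsupp.single i 1 then v 1 else 0 := by
        refine Finset.sum_le_sum fun Q _ => ?_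
        rw [MvPowerSeries.coeff_X]
        split_ifs with h
        · simp [h]
        · simp
    _ ≤ v 1 := by
        rw [Finset.sum_ite_eq']
        split_ifs
        · exact le_rfl
        · exact hv 1

/-- A factor starting in degree `a` leaves at most degree `m - a` to the other. With `a, b ≥ 1` both
norms on the right see only degrees below `m`, which later permits induction on `m`. The weights
need to be compared only in degrees that occur. -/
theorem weightedNorm_mul_le {𝕜 : Type*} [RCLike 𝕜] {n : ℕ} {v u w : ℕ → ℝ}
    (hv : ∀ k, 0 ≤ v k) (hu : ∀ k, 0 ≤ u k) (hw : ∀ k, 0 ≤ w k) {a b : ℕ}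
    (h : ∀ i j, a ≤ i → b ≤ j → v (i + j) ≤ u i * w j) (m : ℕ)
    {f g : MvPowerSeries (Fin n) 𝕜}
    (hf : ∀ A, MvPowerSeries.coeff A f ≠ 0 → a ≤ A.degree)
    (hg : ∀ B, MvPowerSeries.coeff B g ≠ 0 → b ≤ B.degree) :
    weightedNorm v m (f * g) ≤ weightedNorm u (m - b) f * weightedNorm w (m - a) g := by
  classical
  set T : (Fin n →₀ ℕ) × (Fin n →₀ ℕ) → ℝ := fun p =>
    (u p.1.degree * ‖MvPowerSeries.coeff p.1 f‖) * (w p.2.degree * ‖MvPowerSeries.coeff p.2 g‖)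
    with hT
  have hT0 : ∀ p, 0 ≤ T p := fun p => mul_nonneg (mul_nonneg (hu _) (norm_nonneg _))
    (mul_nonneg (hw _) (norm_nonneg _))
  have key : ∀ Q ∈ degreeLE n m, v Q.degree * ‖MvPowerSeries.coeff Q (f * g)‖ ≤
      ∑ p ∈ (degreeLE n (m - b) ×ˢ degreeLE n (m - a)).filter (fun p => p.1 + p.2 = Q), T p := by
    intro Q hQ
    rw [mem_degreeLE] at hQ
    have hterm : ∀ p ∈ Finset.HasAntidiagonal.antidiagonal Q, v Q.degree *
        (‖MvPowerSeries.coeff p.1 f‖ * ‖MvPowerSeries.coeff p.2 g‖) ≤ T p := by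
      intro p hp
      rw [Finset.HasAntidiagonal.mem_antidiagonal] at hp
      by_cases h1 : MvPowerSeries.coeff p.1 f = 0
      · simp [hT, h1]
      by_cases h2 : MvPowerSeries.coeff p.2 g = 0
      · simp [hT, h2]
      have := h _ _ (hf _ h1) (hg _ h2)
      rw [← hp, map_add]
      calc _ ≤ (u p.1.degree * w p.2.degree) *
            (‖MvPowerSeries.coeff p.1 f‖ * ‖MvPowerSeries.coeff p.2 g‖) := by gcongr
        _ = T p := by simp only [hT]; ring
    calc v Q.degree * ‖MvPowerSeries.coeff Q (f * g)‖
        ≤ v Q.degree * ∑ p ∈ Finset.HasAntidiagonal.antidiagonal Q,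
          (‖MvPowerSeries.coeff p.1 f‖ * ‖MvPowerSeries.coeff p.2 g‖) := by
          refine mul_le_mul_of_nonneg_left ?_ (hv _)
          rw [MvPowerSeries.coeff_mul]
          exact (norm_sum_le _ _).trans (Finset.sum_le_sum fun p _ => norm_mul_le _ _)
      _ ≤ ∑ p ∈ Finset.HasAntidiagonal.antidiagonal Q, T p := by
          rw [Finset.mul_sum]
          exact Finset.sum_le_sum hterm
      _ = ∑ p ∈ (Finset.HasAntidiagonal.antidiagonal Q).filter (fun p => T p ≠ 0), T p :=
          (Finset.sum_filter_ne_zero _).symm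
      _ ≤ _ := by
          refine Finset.sum_le_sum_of_subset_of_nonneg (fun p hp => ?_) fun p _ _ => hT0 p
          rw [Finset.mem_filter, Finset.HasAntidiagonal.mem_antidiagonal] at hp
          obtain ⟨hp, hne⟩ := hp
          have h1 := hf p.1 (by rintro h1; exact hne (by simp [hT, h1]))
          have h2 := hg p.2 (by rintro h2; exact hne (by simp [hT, h2]))
          have h3 : p.1.degree + p.2.degree = Q.degree := by rw [← hp, map_add]
          rw [Finset.mem_filter, Finset.mem_product, mem_degreeLE, mem_degreeLE]
          exact ⟨⟨by omega, by omega⟩, hp⟩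
  calc weightedNorm v m (f * g) ≤ _ := Finset.sum_le_sum key
    _ ≤ ∑ p ∈ degreeLE n (m - b) ×ˢ degreeLE n (m - a), T p :=
        Finset.sum_fiberwise_le_sum_of_sum_fiber_nonneg fun _ _ =>
          Finset.sum_nonneg fun p _ => hT0 p
    _ = _ := by
        rw [Finset.sum_product]
        unfold weightedNorm
        rw [Finset.sum_mul_sum]

/-! ### Gevrey weights and their gain on products -/

/-- The Gevrey weight `t^k / (k!)^α`. -/
noncomputable def gevreyWeight (α t : ℝ) (k : ℕ) : ℝ := t ^ k / (k.factorial : ℝ) ^ α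

theorem gevreyWeight_pos {α t : ℝ} (ht : 0 < t) (k : ℕ) : 0 < gevreyWeight α t k := by
  unfold gevreyWeight; positivity

theorem gevreyWeight_zero (α t : ℝ) : gevreyWeight α t 0 = 1 := by simp [gevreyWeight]

theorem gevreyWeight_one (α t : ℝ) : gevreyWeight α t 1 = t := by simp [gevreyWeight]

theorem gevreyWeight_le_pow {α t : ℝ} (hα : 0 ≤ α) (ht : 0 < t) (k : ℕ) :
    gevreyWeight α t k ≤ t ^ k := by
  refine div_le_self (by positivity) (Real.one_le_rpow ?_ hα)
  exact_mod_cast Nat.succ_le_of_lt k.factorial_pos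

theorem gevreyWeight_add_le {α t : ℝ} (hα : 0 ≤ α) (ht : 0 < t) (i j : ℕ) :
    gevreyWeight α t (i + j) ≤ gevreyWeight α t i * gevreyWeight α t j := by
  unfold gevreyWeight
  rw [div_mul_div_comm, ← pow_add, ← Real.mul_rpow (by positivity) (by positivity)]
  have : (i.factorial * j.factorial : ℝ) ≤ ((i + j).factorial : ℝ) := by
    exact_mod_cast Nat.le_of_dvd (Nat.factorial_pos _)
      (Nat.factorial_mul_factorial_dvd_factorial_add i j)
  gcongr

theorem add_le_choose_add {i j : ℕ} (hi : 1 ≤ i) (hj : 1 ≤ j) : i + j ≤ (i + j).choose i := by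
  induction j, hj using Nat.le_induction with
  | base => rw [Nat.choose_succ_self_right]
  | succ j hj ih =>
    obtain ⟨k, rfl⟩ := Nat.exists_eq_add_of_le' hi
    rw [← add_assoc, Nat.choose_succ_succ']
    have : 0 < (k + 1 + j).choose k := Nat.choose_pos (by omega)
    omega

theorem add_mul_factorial_mul_factorial_le {i j : ℕ} (hi : 1 ≤ i) (hj : 1 ≤ j) :
    (i + j) * (i.factorial * j.factorial) ≤ (i + j).factorial := by
  rw [← Nat.add_choose_mul_factorial_mul_factorial i j, mul_assoc]
  refine Nat.mul_le_mul_right _ ?_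
  rw [add_comm]
  exact add_le_choose_add hj hi

/-- The binomial coefficient `(i + j)! / (i! j!)` is at least `i + j` once both indices are
positive; its power `α` is the gain that pays for the small denominators. -/
theorem rpow_mul_gevreyWeight_add_le {α t : ℝ} (hα : 0 ≤ α) (ht : 0 < t) {i j : ℕ}
    (hi : 1 ≤ i) (hj : 1 ≤ j) :
    ((i + j : ℕ) : ℝ) ^ α * gevreyWeight α t (i + j) ≤
      gevreyWeight α t i * gevreyWeight α t j := by
  unfold gevreyWeight
  rw [div_mul_div_comm, ← pow_add, ← Real.mul_rpow (by positivity) (by positivity), mul_div_assoc',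
    div_le_div_iff₀ (by positivity) (by positivity)]
  have : (((i + j : ℕ) : ℝ) * (i.factorial * j.factorial : ℝ)) ^ α ≤
      ((i + j).factorial : ℝ) ^ α := by
    refine Real.rpow_le_rpow (by positivity) ?_ hα
    exact_mod_cast add_mul_factorial_mul_factorial_le hi hj
  rw [Real.mul_rpow (by positivity) (by positivity)] at this
  have h2 := mul_le_mul_of_nonneg_left this (by positivity : 0 ≤ t ^ (i + j))
  linarith

/-! ### Monomials in a family of series, and substitution -/

/-- The monomial `∏ aᵢ ^ Pᵢ` in a family of power series. -/
noncomputable def monomialIn {𝕜 : Type*} [RCLike 𝕜] {n : ℕ}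
    (a : Fin n → MvPowerSeries (Fin n) 𝕜) (P : Fin n →₀ ℕ) : MvPowerSeries (Fin n) 𝕜 :=
  P.prod fun s e => a s ^ e

theorem monomialIn_zero {𝕜 : Type*} [RCLike 𝕜] {n : ℕ} (a : Fin n → MvPowerSeries (Fin n) 𝕜) :
    monomialIn a 0 = 1 := Finsupp.prod_zero_index

theorem monomialIn_add_single {𝕜 : Type*} [RCLike 𝕜] {n : ℕ}
    (a : Fin n → MvPowerSeries (Fin n) 𝕜) (P : Fin n →₀ ℕ) (i : Fin n) :
    monomialIn a (P + Finsupp.single i 1) = monomialIn a P * a i := by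
  unfold monomialIn
  rw [Finsupp.prod_add_index' (by simp) (by simp [pow_add]), Finsupp.prod_single_index (by simp),
    pow_one]

theorem Finsupp.exists_eq_add_single {n : ℕ} {P : Fin n →₀ ℕ} (h : P ≠ 0) :
    ∃ (i : Fin n) (P' : Fin n →₀ ℕ), P = P' + Finsupp.single i 1 := by
  obtain ⟨i, hi⟩ := Finsupp.ne_iff.1 h
  refine ⟨i, P - Finsupp.single i 1, (tsub_add_cancel_of_le ?_).symm⟩
  rw [Finsupp.single_le_iff]
  exact Nat.one_le_iff_ne_zero.2 hi

theorem Finsupp.induction_add_single {n : ℕ} {p : (Fin n →₀ ℕ) → Prop} (h0 : p 0)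
    (h1 : ∀ P i, p P → p (P + Finsupp.single i 1)) (P : Fin n →₀ ℕ) : p P := by
  induction hd : P.degree generalizing P with
  | zero =>
    rw [Finsupp.degree_eq_zero_iff] at hd
    exact hd ▸ h0
  | succ d ih =>
    have hP : P ≠ 0 := by rintro rfl; simp at hd
    obtain ⟨i, P', rfl⟩ := Finsupp.exists_eq_add_single hP
    refine h1 _ _ (ih _ ?_)
    rw [map_add, Finsupp.degree_single] at hd
    omega

theorem weightedNorm_monomialIn_le {𝕜 : Type*} [RCLike 𝕜] {n : ℕ} {α t s : ℝ} (hα : 0 ≤ α)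
    (ht : 0 < t) {m : ℕ} {a : Fin n → MvPowerSeries (Fin n) 𝕜}
    (ha : ∀ i, weightedNorm (gevreyWeight α t) m (a i) ≤ s) (P : Fin n →₀ ℕ) :
    weightedNorm (gevreyWeight α t) m (monomialIn a P) ≤ s ^ P.degree := by
  have h0 : ∀ k, 0 ≤ gevreyWeight α t k := fun k => (gevreyWeight_pos ht k).le
  induction P using Finsupp.induction_add_single with
  | h0 => simp [monomialIn_zero, weightedNorm_one, gevreyWeight_zero]
  | h1 P i ih =>
    rw [monomialIn_add_single, map_add, Finsupp.degree_single, pow_succ]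
    refine (weightedNorm_mul_le (a := 0) (b := 0) h0 h0 h0
      (fun i j _ _ => gevreyWeight_add_le hα ht i j) m (by simp) (by simp)).trans ?_
    exact mul_le_mul ih (ha i) (weightedNorm_nonneg h0 _ _)
      ((weightedNorm_nonneg h0 _ _).trans ih)

theorem le_order_monomialIn {𝕜 : Type*} [RCLike 𝕜] {n : ℕ} {a : Fin n → MvPowerSeries (Fin n) 𝕜}
    (ha : ∀ i, 1 ≤ (a i).order) (P : Fin n →₀ ℕ) : (P.degree : ℕ∞) ≤ (monomialIn a P).order := by
  induction P using Finsupp.induction_add_single with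
  | h0 => simp
  | h1 P i ih =>
    rw [monomialIn_add_single, map_add, Finsupp.degree_single]
    push_cast
    exact (add_le_add ih (ha i)).trans MvPowerSeries.le_order_mul

theorem le_degree_of_le_order {𝕜 : Type*} [RCLike 𝕜] {n : ℕ} {f : MvPowerSeries (Fin n) 𝕜} {k : ℕ}
    (hf : (k : ℕ∞) ≤ f.order) {Q : Fin n →₀ ℕ} (hQ : MvPowerSeries.coeff Q f ≠ 0) :
    k ≤ Q.degree := by
  exact_mod_cast hf.trans (MvPowerSeries.order_le hQ)

/-- Splitting off one factor leaves two series of positive order, since the monomial has degree at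
least two. The gain is used once, at this splitting; plain submultiplicativity handles the rest. -/
theorem weightedNorm_rpow_monomialIn_le {𝕜 : Type*} [RCLike 𝕜] {n : ℕ} {α t s : ℝ} (hα : 0 ≤ α)
    (ht : 0 < t) {m : ℕ} {a : Fin n → MvPowerSeries (Fin n) 𝕜} (ha1 : ∀ i, 1 ≤ (a i).order)
    (ha : ∀ i, weightedNorm (gevreyWeight α t) (m - 1) (a i) ≤ s) {P : Fin n →₀ ℕ}
    (hP : 2 ≤ P.degree) :
    weightedNorm (fun k => (k : ℝ) ^ α * gevreyWeight α t k) m (monomialIn a P) ≤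
      s ^ P.degree := by
  have h0 : ∀ k, 0 ≤ gevreyWeight α t k := fun k => (gevreyWeight_pos ht k).le
  obtain ⟨i, P, rfl⟩ := Finsupp.exists_eq_add_single (P := P) (by rintro rfl; simp at hP)
  rw [map_add, Finsupp.degree_single] at hP
  have hb := weightedNorm_monomialIn_le hα ht ha P
  rw [monomialIn_add_single, map_add, Finsupp.degree_single, pow_succ]
  refine (weightedNorm_mul_le (a := 1) (b := 1) (fun k => mul_nonneg (by positivity) (h0 k)) h0 h0
      (fun i j hi hj => rpow_mul_gevreyWeight_add_le hα ht hi hj) m (fun A hA => ?_)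
      (fun B hB => ?_)).trans ?_
  · have := le_degree_of_le_order (le_order_monomialIn ha1 P) hA
    omega
  · exact le_degree_of_le_order (by exact_mod_cast ha1 i) hB
  · exact mul_le_mul hb (ha i) (weightedNorm_nonneg h0 _ _) ((weightedNorm_nonneg h0 _ _).trans hb)

/-- Telescoping: each term has one difference, of order at least `m`, and `|P| - 1` factors of order
at least one. The `+ 1` on the right avoids a subtraction. -/
theorem le_order_monomialIn_sub {𝕜 : Type*} [RCLike 𝕜] {n : ℕ}
    {a b : Fin n → MvPowerSeries (Fin n) 𝕜}
    (ha : ∀ i, 1 ≤ (a i).order) (hb : ∀ i, 1 ≤ (b i).order) {m : ℕ}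
    (hab : ∀ i, (m : ℕ∞) ≤ (a i - b i).order) (P : Fin n →₀ ℕ) :
    (m : ℕ∞) + P.degree ≤ (monomialIn a P - monomialIn b P).order + 1 := by
  induction P using Finsupp.induction_add_single with
  | h0 => simp [monomialIn_zero]
  | h1 P i ih =>
    have e : monomialIn a (P + Finsupp.single i 1) - monomialIn b (P + Finsupp.single i 1) =
        monomialIn a P * (a i - b i) + (monomialIn a P - monomialIn b P) * b i := by
      rw [monomialIn_add_single, monomialIn_add_single]; ring
    rw [e, map_add, Finsupp.degree_single]
    push_cast
    rw [← add_assoc]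
    refine add_le_add_left (le_trans (le_min ?_ ?_) MvPowerSeries.min_order_le_add) 1
    · rw [add_comm]
      exact (add_le_add (le_order_monomialIn ha P) (hab i)).trans MvPowerSeries.le_order_mul
    · exact (ih.trans (add_le_add_right (hb i) _)).trans MvPowerSeries.le_order_mul

theorem coeff_subst_eq_sum {𝕜 : Type*} [RCLike 𝕜] {n : ℕ} {a : Fin n → MvPowerSeries (Fin n) 𝕜}
    (ha : ∀ i, 1 ≤ (a i).order) (f : MvPowerSeries (Fin n) 𝕜) {m : ℕ} {Q : Fin n →₀ ℕ}
    (hQ : Q.degree ≤ m) :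
    MvPowerSeries.coeff Q (MvPowerSeries.subst a f) =
      ∑ P ∈ degreeLE n m, MvPowerSeries.coeff P f * MvPowerSeries.coeff Q (monomialIn a P) := by
  rw [MvPowerSeries.coeff_subst (MvPowerSeries.hasSubst_of_constantCoeff_zero fun i =>
    MvPowerSeries.one_le_order_iff_constCoeff_eq_zero.1 (ha i))]
  rw [finsum_eq_sum_of_support_subset]
  · rfl
  · intro P hP
    rw [Finset.mem_coe, mem_degreeLE]
    by_contra! hlt
    have h0 : MvPowerSeries.coeff Q (monomialIn a P) = 0 := MvPowerSeries.coeff_of_lt_order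
      (lt_of_lt_of_le (by exact_mod_cast hQ.trans_lt hlt) (le_order_monomialIn ha P))
    exact hP ((congrArg (MvPowerSeries.coeff P f • ·) h0).trans (smul_zero _))

/-! ### Taylor coefficients of analytic maps -/

theorem factorial_sum_le {ι : Type*} (s : Finset ι) (q : ι → ℕ) :
    (∑ i ∈ s, q i).factorial ≤ (2 ^ s.card) ^ (∑ i ∈ s, q i) * ∏ i ∈ s, (q i).factorial := by
  classical
  induction s using Finset.induction_on with
  | empty => simp
  | insert a s ha ih =>
    rw [Finset.sum_insert ha, Finset.prod_insert ha, Finset.card_insert_of_notMem ha,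
      ← Nat.add_choose_mul_factorial_mul_factorial]
    set N := ∑ i ∈ s, q i
    calc (q a + N).choose N * (q a).factorial * N.factorial
        ≤ 2 ^ (q a + N) * (q a).factorial *
          ((2 ^ s.card) ^ (q a + N) * ∏ i ∈ s, (q i).factorial) := by
          gcongr
          · exact Nat.choose_le_two_pow _ _
          · refine ih.trans ?_
            gcongr
            · exact Nat.one_le_two_pow
            · omega
      _ = (2 ^ (s.card + 1)) ^ (q a + N) * ((q a).factorial * ∏ i ∈ s, (q i).factorial) := by
          rw [pow_succ, mul_pow]; ring

theorem sum_degreeLE_pow_le {n m : ℕ} :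
    ∑ P ∈ degreeLE n m, (1 / 2 : ℝ) ^ P.degree ≤ 2 ^ n := by
  classical
  have h1 : ∑ P ∈ degreeLE n m, (1 / 2 : ℝ) ^ P.degree =
      ∑ q ∈ (degreeLE n m).image (fun P : Fin n →₀ ℕ => (P : Fin n → ℕ)),
        ∏ i, (1 / 2 : ℝ) ^ q i := by
    rw [Finset.sum_image fun _ _ _ _ h => DFunLike.coe_injective h]
    exact Finset.sum_congr rfl fun P _ => by
      rw [Finset.prod_pow_eq_pow_sum, Finsupp.degree_eq_sum]
  rw [h1]
  calc _ ≤ ∑ q ∈ Fintype.piFinset fun _ : Fin n => Finset.range (m + 1),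
        ∏ i, (1 / 2 : ℝ) ^ q i := by
        refine Finset.sum_le_sum_of_subset_of_nonneg ?_ fun _ _ _ => by positivity
        intro q hq
        obtain ⟨P, hP, rfl⟩ := Finset.mem_image.1 hq
        rw [Fintype.mem_piFinset]
        intro i
        rw [Finset.mem_range, Nat.lt_succ_iff]
        exact (Finsupp.le_degree i P).trans (mem_degreeLE.1 hP)
    _ = ∏ _i : Fin n, ∑ k ∈ Finset.range (m + 1), (1 / 2 : ℝ) ^ k :=
        (Finset.prod_univ_sum _ _).symm
    _ ≤ ∏ _i : Fin n, (2 : ℝ) := by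
        refine Finset.prod_le_prod (fun _ _ => by positivity) fun _ _ => ?_
        exact sum_geometric_two_le _
    _ = 2 ^ n := by simp

theorem coeff_taylorAtZero {𝕜 : Type*} [RCLike 𝕜] {n : ℕ} (f : (Fin n → 𝕜) → 𝕜)
    (Q : Fin n →₀ ℕ) :
    MvPowerSeries.coeff Q (taylorAtZero f) =
      iteratedFDeriv 𝕜 (∑ i, Q i) f 0
        (fun k => Pi.single (finSigmaFinEquiv.symm k).1 (1 : 𝕜))
      / ((∏ i, (Q i).factorial : ℕ) : 𝕜) := rfl

/-- The iterated derivative is a sum over `|Q|!` permutations of values of the analytic expansion.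
The quotient `|Q|! / Q!` is a multinomial coefficient, at most `2 ^ (n |Q|)`, so the geometric bound
survives. -/
theorem norm_coeff_taylorAtZero_le {𝕜 : Type*} [RCLike 𝕜] {n : ℕ} {f : (Fin n → 𝕜) → 𝕜}
    (hf : AnalyticAt 𝕜 f 0) : ∃ A B : ℝ, 0 < A ∧ 0 < B ∧
      ∀ Q, ‖MvPowerSeries.coeff Q (taylorAtZero f)‖ ≤ A * B ^ Q.degree := by
  obtain ⟨p, r, hp⟩ := hf
  obtain ⟨A, B, hA, hB, hAB⟩ := p.le_mul_pow_of_radius_pos (hp.r_pos.trans_le hp.r_le)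
  refine ⟨A, 2 ^ n * B, hA, by positivity, fun Q => ?_⟩
  rw [coeff_taylorAtZero, hp.iteratedFDeriv_eq_sum_of_completeSpace, norm_div, RCLike.norm_natCast,
    Finsupp.degree_eq_sum]
  have hfac : (0 : ℝ) < ((∏ i, (Q i).factorial : ℕ) : ℝ) := by
    exact_mod_cast Finset.prod_pos fun i _ => (Q i).factorial_pos
  rw [div_le_iff₀ hfac]
  set N := ∑ i, Q i
  have hb : ∀ σ : Equiv.Perm (Fin N), ‖p N (fun i => Pi.single
      (finSigmaFinEquiv.symm (σ i)).1 (1 : 𝕜))‖ ≤ A * B ^ N := by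
    intro σ
    refine ((p N).le_opNorm _).trans ?_
    rw [Finset.prod_eq_one fun i _ => by rw [Pi.norm_single, norm_one], mul_one]
    exact hAB N
  calc _ ≤ ∑ σ : Equiv.Perm (Fin N), A * B ^ N :=
        (norm_sum_le _ _).trans (Finset.sum_le_sum fun σ _ => hb σ)
    _ = (N.factorial : ℝ) * (A * B ^ N) := by
        rw [Finset.sum_const, Finset.card_univ, Fintype.card_perm, Fintype.card_fin, nsmul_eq_mul]
    _ ≤ ((2 ^ n) ^ N * (∏ i, (Q i).factorial : ℕ)) * (A * B ^ N) := by
        gcongr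
        have := factorial_sum_le Finset.univ Q
        rw [Finset.card_univ, Fintype.card_fin] at this
        exact_mod_cast this
    _ = _ := by rw [mul_pow]; ring

theorem coeff_taylorAtZero_of_degree_le_one {𝕜 : Type*} [RCLike 𝕜] {n : ℕ} {f : (Fin n → 𝕜) → 𝕜}
    (h0 : f 0 = 0) (h1 : fderiv 𝕜 f 0 = 0) {Q : Fin n →₀ ℕ} (hQ : Q.degree ≤ 1) :
    MvPowerSeries.coeff Q (taylorAtZero f) = 0 := by
  have key : ∀ (N : ℕ) (_ : N ≤ 1) (v : Fin N → (Fin n → 𝕜)), iteratedFDeriv 𝕜 N f 0 v = 0 := by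
    intro N hN v
    interval_cases N
    · rw [iteratedFDeriv_zero_apply, h0]
    · rw [iteratedFDeriv_one_apply, h1]; rfl
  rw [coeff_taylorAtZero, key _ (by rwa [Finsupp.degree_eq_sum] at hQ), zero_div]

/-! ### Formal solution of the conjugacy equation -/

/-- A map on families of vectors which determines each entry from the entries of smaller
degree has a fixed point. -/
theorem exists_fixedPoint_of_causal {ι E : Type*} [Zero E] (deg : ι → ℕ)
    (Φ : (ι → E) → ι → E)
    (h : ∀ u v i, (∀ i', deg i' < deg i → u i' = v i') → Φ u i = Φ v i) : ∃ u, Φ u = u := by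
  set w : ℕ → ι → E := fun k => Φ^[k] 0
  have hw : ∀ k, w (k + 1) = Φ (w k) := fun k => Function.iterate_succ_apply' Φ k _
  -- An entry of degree `d` is stationary from iterate `d + 1` on, so the limit is read off there.
  have stab : ∀ k i, deg i < k → w (k + 1) i = w k i := by
    intro k
    induction k with
    | zero => intro i hi; omega
    | succ k ih =>
      intro i hi
      rw [hw (k + 1), hw k]
      exact h _ _ _ fun i' hi' => by rw [← hw k]; exact hw k ▸ ih i' (by omega)
  have stab' : ∀ i k, deg i < k → w k i = w (deg i + 1) i := by
    intro i k hk
    induction k, Nat.succ_le_of_lt hk using Nat.le_induction with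
    | base => rfl
    | succ k hk' ih => rw [stab k i hk', ih hk']
  refine ⟨fun i => w (deg i + 1) i, ?_⟩
  funext i
  rw [hw]
  exact h _ _ _ fun i' hi' => (stab' i' _ hi').symm

theorem hasOrderGETwo_iff {𝕜 : Type*} [RCLike 𝕜] {n : ℕ} {F : Fin n → MvPowerSeries (Fin n) 𝕜} :
    HasOrderGETwo F ↔ ∀ j, 2 ≤ (F j).order := by
  refine forall_congr' fun j => ⟨fun h => ?_, fun h Q hQ => ?_⟩
  · refine MvPowerSeries.le_order fun d hd => h d ?_
    have : d.degree < 2 := by exact_mod_cast hd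
    omega
  · refine MvPowerSeries.coeff_of_lt_order (lt_of_lt_of_le ?_ h)
    exact_mod_cast (by omega : Q.degree < 2)

theorem le_order_pderiv {𝕜 : Type*} [RCLike 𝕜] {n : ℕ} {f : MvPowerSeries (Fin n) 𝕜} {k : ℕ}
    (hf : ((k + 1 : ℕ) : ℕ∞) ≤ f.order) (i : Fin n) :
    (k : ℕ∞) ≤ (MvPowerSeries.pderiv 𝕜 i f).order := by
  refine MvPowerSeries.le_order fun d hd => ?_
  rw [MvPowerSeries.coeff_pderiv, MvPowerSeries.coeff_of_lt_order (lt_of_lt_of_le _ hf), zero_mul]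
  rw [map_add, Finsupp.degree_single]
  have : d.degree < k := by exact_mod_cast hd
  exact_mod_cast (by omega : d.degree + 1 < k + 1)

theorem coeff_pderiv_mul_X {𝕜 : Type*} [RCLike 𝕜] {n : ℕ} (f : MvPowerSeries (Fin n) 𝕜)
    (i : Fin n) (Q : Fin n →₀ ℕ) :
    MvPowerSeries.coeff Q (MvPowerSeries.pderiv 𝕜 i f * MvPowerSeries.X i) =
      (Q i : 𝕜) * MvPowerSeries.coeff Q f := by
  classical
  by_cases h : Finsupp.single i 1 ≤ Q
  · obtain ⟨Q, rfl⟩ := exists_add_of_le h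
    rw [MvPowerSeries.X, add_comm, MvPowerSeries.coeff_add_mul_monomial, mul_one,
      MvPowerSeries.coeff_pderiv]
    simp [mul_comm]
  · rw [MvPowerSeries.X, MvPowerSeries.coeff_mul_monomial, if_neg h]
    rw [Finsupp.single_le_iff] at h
    have : Q i = 0 := by omega
    simp [this]

theorem one_le_order_X_add {𝕜 : Type*} [RCLike 𝕜] {n : ℕ} {F : Fin n → MvPowerSeries (Fin n) 𝕜}
    (hF : HasOrderGETwo F) (i : Fin n) : 1 ≤ (MvPowerSeries.X i + F i).order := by
  rw [MvPowerSeries.one_le_order_iff_constCoeff_eq_zero, map_add, MvPowerSeries.constantCoeff_X,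
    zero_add, ← MvPowerSeries.coeff_zero_eq_constantCoeff_apply]
  exact hF i 0 (by simp)

/-- The nonlinear part `R(x + F) - DF · N` of the conjugacy equation. -/
noncomputable def conjugacyRemainder {𝕜 : Type*} [RCLike 𝕜] {n : ℕ}
    (R F N : Fin n → MvPowerSeries (Fin n) 𝕜) (j : Fin n) : MvPowerSeries (Fin n) 𝕜 :=
  MvPowerSeries.subst (fun i => MvPowerSeries.X i + F i) (R j) -
    ∑ k, MvPowerSeries.pderiv 𝕜 k (F j) * N k

/-- The linear part of the equation is diagonal on monomials: `DF · S` multiplies the coefficient of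
`x^Q` by `(Q, λ)`, while `S(x + F)` multiplies it by `λ_j`. -/
theorem conjugates_of_coeff_eq {𝕜 : Type*} [RCLike 𝕜] {n : ℕ} {lam : Fin n → 𝕜}
    {R F N : Fin n → MvPowerSeries (Fin n) 𝕜} (hF : HasOrderGETwo F)
    (h : ∀ j Q, (weightedSum lam Q - lam j) * MvPowerSeries.coeff Q (F j) +
      MvPowerSeries.coeff Q (N j) = MvPowerSeries.coeff Q (conjugacyRemainder R F N j)) :
    Conjugates F (fun j => diagonalField lam j + R j) (fun j => diagonalField lam j + N j) := by
  intro j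
  have hs : MvPowerSeries.HasSubst (fun i => MvPowerSeries.X i + F i) :=
    MvPowerSeries.hasSubst_of_constantCoeff_zero fun i =>
      MvPowerSeries.one_le_order_iff_constCoeff_eq_zero.1 (one_le_order_X_add hF i)
  have hsum : ∀ Q, MvPowerSeries.coeff Q (∑ k, MvPowerSeries.pderiv 𝕜 k (F j) *
      diagonalField lam k) = weightedSum lam Q * MvPowerSeries.coeff Q (F j) := by
    intro Q
    rw [map_sum, weightedSum, Finset.sum_mul]
    refine Finset.sum_congr rfl fun k _ => ?_
    rw [diagonalField, mul_left_comm, MvPowerSeries.coeff_C_mul, coeff_pderiv_mul_X]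
    ring
  have hsubst : MvPowerSeries.subst (fun i => MvPowerSeries.X i + F i) (diagonalField lam j) =
      MvPowerSeries.C (lam j) * (MvPowerSeries.X j + F j) := by
    rw [diagonalField, MvPowerSeries.subst_mul hs, MvPowerSeries.subst_X hs,
      MvPowerSeries.subst_C]
  ext Q
  have := h j Q
  rw [conjugacyRemainder, map_sub] at this
  rw [MvPowerSeries.subst_add hs, hsubst]
  simp only [mul_add, Finset.sum_add_distrib, map_add]
  rw [hsum, diagonalField]
  simp only [MvPowerSeries.coeff_C_mul]
  linear_combination this

theorem coeff_conjugacyRemainder_of_degree_le_one {𝕜 : Type*} [RCLike 𝕜] {n : ℕ}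
    {R F N : Fin n → MvPowerSeries (Fin n) 𝕜} (hR : HasOrderGETwo R) (hF : HasOrderGETwo F)
    (hN : HasOrderGETwo N) (j : Fin n) {Q : Fin n →₀ ℕ} (hQ : Q.degree ≤ 1) :
    MvPowerSeries.coeff Q (conjugacyRemainder R F N j) = 0 := by
  have ha := one_le_order_X_add hF
  rw [conjugacyRemainder, map_sub, map_sum, coeff_subst_eq_sum ha _ hQ,
    Finset.sum_eq_zero fun P hP => by rw [hR j P (mem_degreeLE.1 hP), zero_mul],
    Finset.sum_eq_zero, sub_zero]
  intro k _
  refine MvPowerSeries.coeff_of_lt_order (lt_of_lt_of_le ?_ (le_trans (add_le_add (le_order_pderiv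
    (k := 1) (hasOrderGETwo_iff.1 hF j) k) (hasOrderGETwo_iff.1 hN k)) MvPowerSeries.le_order_mul))
  exact_mod_cast (by omega : Q.degree < 1 + 2)

/-- A derivative lowers the degree by one, but the other factor raises it by at least two; likewise
each monomial of `R` has at least two factors of positive order. Hence only lower degrees enter. -/
theorem coeff_conjugacyRemainder_congr {𝕜 : Type*} [RCLike 𝕜] {n : ℕ}
    {R F N F' N' : Fin n → MvPowerSeries (Fin n) 𝕜} (hR : HasOrderGETwo R) (hF : HasOrderGETwo F)
    (hN : HasOrderGETwo N) (hF' : HasOrderGETwo F') {Q : Fin n →₀ ℕ}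
    (hFF : ∀ k P, P.degree < Q.degree → MvPowerSeries.coeff P (F k) = MvPowerSeries.coeff P (F' k))
    (hNN : ∀ k P, P.degree < Q.degree → MvPowerSeries.coeff P (N k) = MvPowerSeries.coeff P (N' k))
    (j : Fin n) (hQ : 2 ≤ Q.degree) :
    MvPowerSeries.coeff Q (conjugacyRemainder R F N j) =
      MvPowerSeries.coeff Q (conjugacyRemainder R F' N' j) := by
  obtain ⟨m, hm⟩ := Nat.exists_eq_add_of_le' (show 1 ≤ Q.degree by omega)
  have hFo : ∀ k, (Q.degree : ℕ∞) ≤ (F k - F' k).order := fun k =>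
    MvPowerSeries.nat_le_order fun P hP => by rw [map_sub, hFF k P hP, sub_self]
  have hNo : ∀ k, (Q.degree : ℕ∞) ≤ (N k - N' k).order := fun k =>
    MvPowerSeries.nat_le_order fun P hP => by rw [map_sub, hNN k P hP, sub_self]
  rw [conjugacyRemainder, conjugacyRemainder, map_sub, map_sub, map_sum, map_sum,
    coeff_subst_eq_sum (one_le_order_X_add hF) _ le_rfl,
    coeff_subst_eq_sum (one_le_order_X_add hF') _ le_rfl]
  congr 1
  · refine Finset.sum_congr rfl fun P _ => ?_
    by_cases hP : P.degree ≤ 1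
    · rw [hR j P hP, zero_mul, zero_mul]
    · congr 1
      rw [← sub_eq_zero, ← map_sub]
      refine MvPowerSeries.coeff_of_lt_order ?_
      have h1 := le_order_monomialIn_sub (one_le_order_X_add hF) (one_le_order_X_add hF')
        (m := Q.degree) (fun i => by rw [add_sub_add_left_eq_sub]; exact hFo i) P
      have h2 : ((Q.degree + 1 + 1 : ℕ) : ℕ∞) ≤ Q.degree + P.degree := by
        exact_mod_cast (by omega : Q.degree + 1 + 1 ≤ Q.degree + P.degree)
      have h3 := h2.trans h1
      push_cast at h3
      have h4 := (ENat.add_le_add_iff_right ENat.one_ne_top).1 h3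
      exact lt_of_lt_of_le (by exact_mod_cast Nat.lt_succ_self Q.degree) h4
  · refine Finset.sum_congr rfl fun k _ => ?_
    rw [← sub_eq_zero, ← map_sub]
    have e : MvPowerSeries.pderiv 𝕜 k (F j) * N k - MvPowerSeries.pderiv 𝕜 k (F' j) * N' k =
        MvPowerSeries.pderiv 𝕜 k (F j - F' j) * N k +
          MvPowerSeries.pderiv 𝕜 k (F' j) * (N k - N' k) := by
      rw [map_sub]; ring
    have h1 := hFo j
    rw [hm] at h1
    rw [e, map_add, MvPowerSeries.coeff_of_lt_order, MvPowerSeries.coeff_of_lt_order, add_zero]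
    · refine lt_of_lt_of_le ?_ (le_trans (add_le_add (le_order_pderiv (k := 1)
        (hasOrderGETwo_iff.1 hF' j) k) (hNo k)) MvPowerSeries.le_order_mul)
      exact_mod_cast (by omega : Q.degree < 1 + Q.degree)
    · refine lt_of_lt_of_le ?_ (le_trans (add_le_add (le_order_pderiv h1 k)
        (hasOrderGETwo_iff.1 hN k)) MvPowerSeries.le_order_mul)
      exact_mod_cast (by omega : Q.degree < m + 2)

/-- The formal Poincaré–Dulac normal form: the homological equation is solved degree by degree,
with a nonresonant transformation and a resonant normal form. -/
theorem exists_formal_normalForm {𝕜 : Type*} [RCLike 𝕜] {n : ℕ} (lam : Fin n → 𝕜)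
    {R : Fin n → MvPowerSeries (Fin n) 𝕜} (hR : HasOrderGETwo R) :
    ∃ F N : Fin n → MvPowerSeries (Fin n) 𝕜, HasOrderGETwo F ∧ HasOrderGETwo N ∧
      IsResonant lam N ∧ ∀ j Q, (weightedSum lam Q - lam j) * MvPowerSeries.coeff Q (F j) +
        MvPowerSeries.coeff Q (N j) = MvPowerSeries.coeff Q (conjugacyRemainder R F N j) := by
  classical
  -- `S` erases degrees 0 and 1, so that causality holds for arbitrary families `u`.
  obtain ⟨S, hSc⟩ : ∃ S : (Fin n × (Fin n →₀ ℕ) → 𝕜) → Fin n → MvPowerSeries (Fin n) 𝕜,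
      ∀ u j Q, MvPowerSeries.coeff Q (S u j) = if Q.degree ≤ 1 then 0 else u (j, Q) :=
    ⟨fun u j Q => if Q.degree ≤ 1 then 0 else u (j, Q), fun _ _ _ => rfl⟩
  have hS2 : ∀ u, HasOrderGETwo (S u) := fun u j Q hQ => by rw [hSc, if_pos hQ]
  let G : (Fin n × (Fin n →₀ ℕ) → 𝕜 × 𝕜) → Fin n × (Fin n →₀ ℕ) → 𝕜 := fun u i =>
    MvPowerSeries.coeff i.2 (conjugacyRemainder R (S fun i => (u i).1) (S fun i => (u i).2) i.1)
  let Φ : (Fin n × (Fin n →₀ ℕ) → 𝕜 × 𝕜) → Fin n × (Fin n →₀ ℕ) → 𝕜 × 𝕜 := fun u i =>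
    if lam i.1 = weightedSum lam i.2 then (0, G u i)
    else (G u i / (weightedSum lam i.2 - lam i.1), 0)
  obtain ⟨u, hu⟩ := exists_fixedPoint_of_causal (fun i : Fin n × (Fin n →₀ ℕ) => i.2.degree) Φ
    (by
      intro u v i huv
      have hG : G u i = G v i := by
        by_cases hi : i.2.degree ≤ 1
        · exact (coeff_conjugacyRemainder_of_degree_le_one hR (hS2 _) (hS2 _) _ hi).trans
            (coeff_conjugacyRemainder_of_degree_le_one hR (hS2 _) (hS2 _) _ hi).symm
        · refine coeff_conjugacyRemainder_congr hR (hS2 _) (hS2 _) (hS2 _) (fun k P hP => ?_)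
            (fun k P hP => ?_) _ (by omega)
          · rw [hSc, hSc, huv (k, P) hP]
          · rw [hSc, hSc, huv (k, P) hP]
      simp only [Φ, hG])
  refine ⟨S fun i => (u i).1, S fun i => (u i).2, hS2 _, hS2 _, fun j Q hQ => ?_, fun j Q => ?_⟩
  · by_contra hne
    have := congrFun hu (j, Q)
    simp only [Φ, if_neg hne] at this
    rw [hSc, ← this] at hQ
    simp at hQ
  · by_cases hQ : Q.degree ≤ 1
    · rw [hS2 _ j Q hQ, hS2 _ j Q hQ,
        coeff_conjugacyRemainder_of_degree_le_one hR (hS2 _) (hS2 _) _ hQ]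
      simp
    · have := congrFun hu (j, Q)
      rw [hSc, hSc, if_neg hQ, if_neg hQ, ← this]
      simp only [Φ]
      split_ifs with h
      · simp [G]
      · have h' : weightedSum lam Q - lam j ≠ 0 := sub_ne_zero.2 (Ne.symm h)
        simp only [add_zero, G]
        field_simp

/-! ### Estimates for the nonlinear terms and the denominators -/

theorem weightedNorm_mono_weight {𝕜 : Type*} [RCLike 𝕜] {n : ℕ} {v w : ℕ → ℝ}
    (h : ∀ k, v k ≤ w k) (m : ℕ) (f : MvPowerSeries (Fin n) 𝕜) :
    weightedNorm v m f ≤ weightedNorm w m f :=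
  Finset.sum_le_sum fun _ _ => mul_le_mul_of_nonneg_right (h _) (norm_nonneg _)

theorem weightedNorm_subst_le {𝕜 : Type*} [RCLike 𝕜] {n : ℕ} {v : ℕ → ℝ} (hv : ∀ k, 0 ≤ v k)
    (m : ℕ) {a : Fin n → MvPowerSeries (Fin n) 𝕜} (ha : ∀ i, 1 ≤ (a i).order)
    (f : MvPowerSeries (Fin n) 𝕜) :
    weightedNorm v m (MvPowerSeries.subst a f) ≤
      ∑ P ∈ degreeLE n m, ‖MvPowerSeries.coeff P f‖ * weightedNorm v m (monomialIn a P) := by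
  simp only [weightedNorm, Finset.mul_sum]
  rw [Finset.sum_comm]
  refine Finset.sum_le_sum fun Q hQ => ?_
  rw [coeff_subst_eq_sum ha f (mem_degreeLE.1 hQ)]
  refine (mul_le_mul_of_nonneg_left (norm_sum_le _ _) (hv _)).trans (le_of_eq ?_)
  rw [Finset.mul_sum]
  refine Finset.sum_congr rfl fun P _ => ?_
  rw [norm_mul]; ring

theorem weightedNorm_subst_le_sq {𝕜 : Type*} [RCLike 𝕜] {n : ℕ} {α t A B : ℝ} (hα : 0 ≤ α)
    (ht : 0 < t) (hA : 0 < A) (hB : 0 < B) (htB : 4 * B * t ≤ 1) {m : ℕ}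
    {a : Fin n → MvPowerSeries (Fin n) 𝕜} (ha1 : ∀ i, 1 ≤ (a i).order)
    (ha : ∀ i, weightedNorm (gevreyWeight α t) (m - 1) (a i) ≤ 2 * t)
    {f : MvPowerSeries (Fin n) 𝕜} (hf2 : ∀ P, P.degree ≤ 1 → MvPowerSeries.coeff P f = 0)
    (hf : ∀ P, ‖MvPowerSeries.coeff P f‖ ≤ A * B ^ P.degree) :
    weightedNorm (fun k => (k : ℝ) ^ α * gevreyWeight α t k) m (MvPowerSeries.subst a f) ≤
      16 * A * B ^ 2 * 2 ^ n * t ^ 2 := by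
  have h0 : ∀ k : ℕ, 0 ≤ (k : ℝ) ^ α * gevreyWeight α t k := fun k =>
    mul_nonneg (by positivity) (gevreyWeight_pos ht k).le
  calc _ ≤ _ := weightedNorm_subst_le h0 m ha1 f
    _ ≤ ∑ P ∈ degreeLE n m, A * (4 * B * t) ^ 2 * (1 / 2) ^ P.degree := by
        refine Finset.sum_le_sum fun P _ => ?_
        by_cases hP : P.degree ≤ 1
        · rw [hf2 P hP, norm_zero, zero_mul]
          positivity
        · calc _ ≤ (A * B ^ P.degree) * (2 * t) ^ P.degree :=
                mul_le_mul (hf P) (weightedNorm_rpow_monomialIn_le hα ht ha1 ha (by omega))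
                  (weightedNorm_nonneg h0 _ _) (by positivity)
            -- Half of the ratio is kept for summability over `P`; the rest yields the quadratic
            -- factor, as `|P| ≥ 2`.
            _ = A * (4 * B * t) ^ P.degree * (1 / 2) ^ P.degree := by
                rw [mul_assoc, mul_assoc, ← mul_pow, ← mul_pow]; congr 2; ring
            _ ≤ _ := by
                gcongr A * ?_ * _
                exact pow_le_pow_of_le_one (by positivity) htB (by omega)
    _ = A * (4 * B * t) ^ 2 * ∑ P ∈ degreeLE n m, (1 / 2 : ℝ) ^ P.degree := by
        rw [Finset.mul_sum]
    _ ≤ A * (4 * B * t) ^ 2 * 2 ^ n := by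
        gcongr
        exact sum_degreeLE_pow_le
    _ = _ := by ring

theorem weightedNorm_pderiv_le {𝕜 : Type*} [RCLike 𝕜] {n : ℕ} {v : ℕ → ℝ} (hv : ∀ k, 0 ≤ v k)
    (m : ℕ) (i : Fin n) (f : MvPowerSeries (Fin n) 𝕜) :
    weightedNorm (fun k => v (k + 1) / ((k + 1 : ℕ) : ℝ)) m (MvPowerSeries.pderiv 𝕜 i f) ≤
      weightedNorm v (m + 1) f := by
  classical
  calc _ ≤ ∑ Q ∈ degreeLE n m, v (Q + Finsupp.single i 1).degree *
        ‖MvPowerSeries.coeff (Q + Finsupp.single i 1) f‖ := by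
        refine Finset.sum_le_sum fun Q _ => ?_
        rw [MvPowerSeries.coeff_pderiv, norm_mul, map_add, Finsupp.degree_single]
        have h1 : ‖((Q i : 𝕜) + 1)‖ ≤ ((Q.degree + 1 : ℕ) : ℝ) := by
          rw [← Nat.cast_succ, RCLike.norm_natCast]
          exact_mod_cast Nat.succ_le_succ (Finsupp.le_degree i Q)
        calc _ ≤ v (Q.degree + 1) / ((Q.degree + 1 : ℕ) : ℝ) *
              (‖MvPowerSeries.coeff (Q + Finsupp.single i 1) f‖ * ((Q.degree + 1 : ℕ) : ℝ)) := by
              refine mul_le_mul_of_nonneg_left ?_ (div_nonneg (hv _) (by positivity))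
              exact mul_le_mul_of_nonneg_left h1 (norm_nonneg _)
          _ = _ := by field_simp
    _ = ∑ Q ∈ (degreeLE n m).image (fun Q => Q + Finsupp.single i 1), v Q.degree *
        ‖MvPowerSeries.coeff Q f‖ := by
        rw [Finset.sum_image fun _ _ _ _ h => add_right_cancel h]
    _ ≤ _ := by
        refine Finset.sum_le_sum_of_subset_of_nonneg ?_
          fun _ _ _ => mul_nonneg (hv _) (norm_nonneg _)
        intro Q hQ
        obtain ⟨P, hP, rfl⟩ := Finset.mem_image.1 hQ
        rw [mem_degreeLE] at hP ⊢
        rw [map_add, Finsupp.degree_single]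
        omega

theorem weightedNorm_shift_le {𝕜 : Type*} [RCLike 𝕜] {n : ℕ} {α t : ℝ} (hα : 0 ≤ α)
    (ht : 0 < t) (ht1 : t ≤ 1) {K : ℕ} (m : ℕ) {g : MvPowerSeries (Fin n) 𝕜} (hg : 2 ≤ g.order)
    (hgK : ∀ Q, K ≤ Q.degree → MvPowerSeries.coeff Q g = 0) :
    weightedNorm (fun k => gevreyWeight α t (k - 1)) m g ≤
      t * ∑ Q ∈ degreeLE n K, ‖MvPowerSeries.coeff Q g‖ := by
  classical
  calc _ = ∑ Q ∈ (degreeLE n m).filter (fun Q => MvPowerSeries.coeff Q g ≠ 0),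
        gevreyWeight α t (Q.degree - 1) * ‖MvPowerSeries.coeff Q g‖ := by
        refine (Finset.sum_filter_of_ne ?_).symm
        intro Q _ h h0
        exact h (by rw [h0, norm_zero, mul_zero])
    _ ≤ ∑ Q ∈ (degreeLE n m).filter (fun Q => MvPowerSeries.coeff Q g ≠ 0),
        t * ‖MvPowerSeries.coeff Q g‖ := by
        refine Finset.sum_le_sum fun Q hQ => mul_le_mul_of_nonneg_right ?_ (norm_nonneg _)
        have h2 : 2 ≤ Q.degree :=
          le_degree_of_le_order (by exact_mod_cast hg) (Finset.mem_filter.1 hQ).2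
        exact (gevreyWeight_le_pow hα ht _).trans (pow_le_of_le_one ht.le ht1 (by omega))
    _ ≤ ∑ Q ∈ degreeLE n K, t * ‖MvPowerSeries.coeff Q g‖ := by
        refine Finset.sum_le_sum_of_subset_of_nonneg (fun Q hQ => ?_) fun _ _ _ => by positivity
        rw [mem_degreeLE]
        by_contra! h
        exact (Finset.mem_filter.1 hQ).2 (hgK Q h.le)
    _ = _ := by rw [Finset.mul_sum]

/-- With degrees `i` from the derivative and `j ≥ 2` from `g`, one degree is moved across: `i + j =
(i + 1) + (j - 1)`. Both parts are positive, so the gain applies, and `1 / (i + j) ≤ 1 / (i + 1)`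
absorbs the factor produced by differentiation. -/
theorem weightedNorm_pderiv_mul_le {𝕜 : Type*} [RCLike 𝕜] {n : ℕ} {α t : ℝ} (hα : 0 ≤ α)
    (ht : 0 < t) (ht1 : t ≤ 1) {K m : ℕ} (hm : 2 ≤ m) (i : Fin n) {f g : MvPowerSeries (Fin n) 𝕜}
    (hf : 2 ≤ f.order) (hg : 2 ≤ g.order)
    (hgK : ∀ Q, K ≤ Q.degree → MvPowerSeries.coeff Q g = 0) :
    weightedNorm (fun k => (k : ℝ) ^ α * gevreyWeight α t k / k) m
        (MvPowerSeries.pderiv 𝕜 i f * g) ≤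
      weightedNorm (gevreyWeight α t) (m - 1) f *
        (t * ∑ Q ∈ degreeLE n K, ‖MvPowerSeries.coeff Q g‖) := by
  have h0 : ∀ k, 0 ≤ gevreyWeight α t k := fun k => (gevreyWeight_pos ht k).le
  have hu : ∀ k : ℕ, 0 ≤ gevreyWeight α t (k + 1) / ((k + 1 : ℕ) : ℝ) := fun k =>
    div_nonneg (h0 _) (by positivity)
  refine (weightedNorm_mul_le (a := 1) (b := 2)
    (u := fun k => gevreyWeight α t (k + 1) / ((k + 1 : ℕ) : ℝ))
    (w := fun k => gevreyWeight α t (k - 1))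
    (fun k => div_nonneg (mul_nonneg (by positivity) (h0 k)) (by positivity)) hu
    (fun k => h0 _) (fun i j hi hj => ?_) m (fun Q hQ => ?_) (fun Q hQ => ?_)).trans ?_
  · have h1 := rpow_mul_gevreyWeight_add_le hα ht (show 1 ≤ i + 1 by omega)
      (show 1 ≤ j - 1 by omega)
    rw [show i + 1 + (j - 1) = i + j by omega] at h1
    calc _ ≤ gevreyWeight α t (i + 1) * gevreyWeight α t (j - 1) / ((i + 1 : ℕ) : ℝ) := by
          refine div_le_div₀ (mul_nonneg (h0 _) (h0 _)) h1 (by positivity) ?_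
          exact_mod_cast (by omega : i + 1 ≤ i + j)
      _ = _ := by ring
  · exact le_degree_of_le_order (le_order_pderiv (k := 1) (by exact_mod_cast hf) i) hQ
  · exact le_degree_of_le_order (by exact_mod_cast hg) hQ
  · refine mul_le_mul ?_ (weightedNorm_shift_le hα ht ht1 _ hg hgK)
      (weightedNorm_nonneg (fun k => h0 _) _ _) (weightedNorm_nonneg h0 _ _)
    have := weightedNorm_pderiv_le h0 (m - 2) i f
    rwa [show m - 2 + 1 = m - 1 by omega] at this

/-- Dividing by `C k^(1-α)` turns the weight into `k^(α-1) w_k`. The finitely many low degrees are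
not controlled by `g`, but order at least two makes them `O(t²)`. -/
theorem weightedNorm_le_of_denominator_bound {𝕜 : Type*} [RCLike 𝕜] {n : ℕ} {α t C : ℝ}
    (hα : 0 ≤ α) (ht : 0 < t) (ht1 : t ≤ 1) (hC : 0 < C) {K : ℕ} (m : ℕ)
    {f g : MvPowerSeries (Fin n) 𝕜} (hf : 2 ≤ f.order)
    (hfg : ∀ Q : Fin n →₀ ℕ, K ≤ Q.degree →
      C * (Q.degree : ℝ) ^ (1 - α) * ‖MvPowerSeries.coeff Q f‖ ≤ ‖MvPowerSeries.coeff Q g‖) :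
    weightedNorm (gevreyWeight α t) m f ≤
      t ^ 2 * ∑ Q ∈ degreeLE n K, ‖MvPowerSeries.coeff Q f‖ +
        C⁻¹ * weightedNorm (fun k => (k : ℝ) ^ α * gevreyWeight α t k / k) m g := by
  classical
  have h0 : ∀ k, 0 ≤ gevreyWeight α t k := fun k => (gevreyWeight_pos ht k).le
  have hpt : ∀ Q ∈ degreeLE n m, gevreyWeight α t Q.degree * ‖MvPowerSeries.coeff Q f‖ ≤
      (if Q.degree ≤ K then t ^ 2 * ‖MvPowerSeries.coeff Q f‖ else 0) +
        C⁻¹ * (((Q.degree : ℝ) ^ α * gevreyWeight α t Q.degree / Q.degree) *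
          ‖MvPowerSeries.coeff Q g‖) := by
    intro Q _
    have hr : 0 ≤ C⁻¹ * (((Q.degree : ℝ) ^ α * gevreyWeight α t Q.degree / Q.degree) *
          ‖MvPowerSeries.coeff Q g‖) := by
      have := h0 Q.degree
      positivity
    by_cases hQ0 : MvPowerSeries.coeff Q f = 0
    · rw [hQ0, norm_zero, mul_zero]
      refine add_nonneg ?_ hr
      split_ifs <;> simp
    have hQ2 : 2 ≤ Q.degree := le_degree_of_le_order (by exact_mod_cast hf) hQ0
    split_ifs with hK
    · refine le_add_of_le_of_nonneg (mul_le_mul_of_nonneg_right ?_ (norm_nonneg _)) hr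
      exact (gevreyWeight_le_pow hα ht _).trans (pow_le_pow_of_le_one ht.le ht1 hQ2)
    · rw [zero_add]
      have hk : (0 : ℝ) < Q.degree := by exact_mod_cast (by omega : 0 < Q.degree)
      have h1 := hfg Q (by omega)
      rw [Real.rpow_sub hk, Real.rpow_one] at h1
      have hka : 0 < (Q.degree : ℝ) ^ α := Real.rpow_pos_of_pos hk α
      calc _ = C⁻¹ * (((Q.degree : ℝ) ^ α * gevreyWeight α t Q.degree / Q.degree) *
            (C * (Q.degree / (Q.degree : ℝ) ^ α) * ‖MvPowerSeries.coeff Q f‖)) := by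
            field_simp
        _ ≤ _ := by
            have := h0 Q.degree
            gcongr
  calc _ ≤ _ := Finset.sum_le_sum hpt
    _ = ∑ Q ∈ (degreeLE n m).filter (fun Q => Q.degree ≤ K), t ^ 2 * ‖MvPowerSeries.coeff Q f‖ +
        C⁻¹ * weightedNorm (fun k => (k : ℝ) ^ α * gevreyWeight α t k / k) m g := by
        rw [Finset.sum_add_distrib, Finset.sum_filter, weightedNorm, Finset.mul_sum]
    _ ≤ _ := by
        gcongr
        rw [Finset.mul_sum]
        refine Finset.sum_le_sum_of_subset_of_nonneg (fun Q hQ => ?_) fun _ _ _ => by positivity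
        exact mem_degreeLE.2 (Finset.mem_filter.1 hQ).2

/-! ### Closing the induction and the Gevrey bound -/

theorem exists_weightedNorm_le {𝕜 : Type*} [RCLike 𝕜] {n : ℕ} {α A B C : ℝ} (hα : 0 ≤ α)
    (hA : 0 < A) (hB : 0 < B) (hC : 0 < C) {K : ℕ} {R F N : Fin n → MvPowerSeries (Fin n) 𝕜}
    (hR : HasOrderGETwo R) (hF : HasOrderGETwo F) (hN : HasOrderGETwo N)
    (hRb : ∀ j P, ‖MvPowerSeries.coeff P (R j)‖ ≤ A * B ^ P.degree)
    (hNK : ∀ j Q, K ≤ Q.degree → MvPowerSeries.coeff Q (N j) = 0)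
    (hFG : ∀ j (Q : Fin n →₀ ℕ), K ≤ Q.degree →
      C * (Q.degree : ℝ) ^ (1 - α) * ‖MvPowerSeries.coeff Q (F j)‖ ≤
        ‖MvPowerSeries.coeff Q (conjugacyRemainder R F N j)‖) :
    ∃ t : ℝ, 0 < t ∧ ∀ m j, weightedNorm (gevreyWeight α t) m (F j) ≤ t := by
  set D : ℝ := ∑ j, ∑ Q ∈ degreeLE n K, ‖MvPowerSeries.coeff Q (F j)‖ with hD
  set E : ℝ := ∑ k, ∑ Q ∈ degreeLE n K, ‖MvPowerSeries.coeff Q (N k)‖ with hE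
  have hD0 : 0 ≤ D := by positivity
  have hE0 : 0 ≤ E := by positivity
  set L : ℝ := D + C⁻¹ * (16 * A * B ^ 2 * 2 ^ n + E) with hL
  have hL0 : 0 ≤ L := by positivity
  have hM : 0 < 1 + 4 * B + L := by positivity
  -- This choice ensures `t ≤ 1`, `4 B t ≤ 1` and `L t ≤ 1` at once.
  set t : ℝ := (1 + 4 * B + L)⁻¹ with htdef
  have ht : 0 < t := inv_pos.2 hM
  have htM : (1 + 4 * B + L) * t = 1 := mul_inv_cancel₀ hM.ne'
  have hBt : 0 < B * t := by positivity
  have hLt : 0 ≤ L * t := by positivity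
  have ht1 : t ≤ 1 := by linarith
  have htB : 4 * B * t ≤ 1 := by linarith
  have htL : L * t ≤ 1 := by linarith
  have h0 : ∀ k, 0 ≤ gevreyWeight α t k := fun k => (gevreyWeight_pos ht k).le
  have h0' : ∀ k : ℕ, 0 ≤ (k : ℝ) ^ α * gevreyWeight α t k / k := fun k => by
    have := h0 k
    positivity
  have hF2 := hasOrderGETwo_iff.1 hF
  have hN2 := hasOrderGETwo_iff.1 hN
  refine ⟨t, ht, fun m => ?_⟩
  induction m using Nat.strong_induction_on with
  | _ m ih =>
    intro j
    by_cases hm : m ≤ 1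
    · have : weightedNorm (gevreyWeight α t) m (F j) = 0 := Finset.sum_eq_zero fun Q hQ => by
        rw [hF j Q ((mem_degreeLE.1 hQ).trans hm), norm_zero, mul_zero]
      rw [this]; exact ht.le
    have ihm := ih (m - 1) (by omega)
    have hX : ∀ i, weightedNorm (gevreyWeight α t) (m - 1) (MvPowerSeries.X i + F i) ≤ 2 * t := by
      intro i
      have h1 := weightedNorm_X_le (𝕜 := 𝕜) h0 (m - 1) i
      rw [gevreyWeight_one] at h1
      linarith [weightedNorm_add_le h0 (m - 1) (MvPowerSeries.X i) (F i), ihm i]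
    have hsub := weightedNorm_subst_le_sq hα ht hA hB htB (one_le_order_X_add hF) hX
      (fun P hP => hR j P hP) (hRb j)
    -- The substitution term has a factor `k` to spare; it is dropped to match the weight of the
    -- derivative term.
    have hsub' := (weightedNorm_mono_weight (v := fun k : ℕ => (k : ℝ) ^ α * gevreyWeight α t k / k)
      (w := fun k : ℕ => (k : ℝ) ^ α * gevreyWeight α t k) (fun k => by
        rcases Nat.eq_zero_or_pos k with rfl | hk
        · have := h0 0
          simp only [Nat.cast_zero, div_zero]
          positivity
        · exact div_le_self (mul_nonneg (by positivity) (h0 k)) (by exact_mod_cast hk)) m _).trans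
      hsub
    have hder : weightedNorm (fun k : ℕ => (k : ℝ) ^ α * gevreyWeight α t k / k) m
        (∑ k, MvPowerSeries.pderiv 𝕜 k (F j) * N k) ≤ t ^ 2 * E := by
      refine (weightedNorm_sum_le h0' _ _ _).trans ?_
      rw [hE, Finset.mul_sum]
      refine Finset.sum_le_sum fun k _ => ?_
      refine (weightedNorm_pderiv_mul_le hα ht ht1 (by omega) k (hF2 j) (hN2 k) (hNK k)).trans ?_
      rw [pow_two, mul_assoc]
      exact mul_le_mul_of_nonneg_right (ihm j) (by positivity)
    have hG : weightedNorm (fun k : ℕ => (k : ℝ) ^ α * gevreyWeight α t k / k) m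
        (conjugacyRemainder R F N j) ≤ 16 * A * B ^ 2 * 2 ^ n * t ^ 2 + t ^ 2 * E := by
      rw [conjugacyRemainder, sub_eq_add_neg]
      refine (weightedNorm_add_le h0' _ _ _).trans (add_le_add hsub' ?_)
      rw [weightedNorm_neg]
      exact hder
    have hDj : ∑ Q ∈ degreeLE n K, ‖MvPowerSeries.coeff Q (F j)‖ ≤ D :=
      Finset.single_le_sum (f := fun j => ∑ Q ∈ degreeLE n K, ‖MvPowerSeries.coeff Q (F j)‖)
        (fun _ _ => by positivity) (Finset.mem_univ j)
    calc _ ≤ _ := weightedNorm_le_of_denominator_bound hα ht ht1 hC m (hF2 j) (hFG j)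
      _ ≤ t ^ 2 * D + C⁻¹ * (16 * A * B ^ 2 * 2 ^ n * t ^ 2 + t ^ 2 * E) := by gcongr
      _ = (L * t) * t := by rw [hL]; ring
      _ ≤ 1 * t := by gcongr
      _ = t := one_mul t

theorem isGevrey_of_weightedNorm_le {𝕜 : Type*} [RCLike 𝕜] {n : ℕ} {α t M : ℝ} (ht : 0 < t)
    (hM : 0 < M) {f : MvPowerSeries (Fin n) 𝕜}
    (hf : ∀ m, weightedNorm (gevreyWeight α t) m f ≤ M) : IsGevrey α f := by
  refine ⟨M, t⁻¹, hM, inv_pos.2 ht, fun Q => ?_⟩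
  have h1 : gevreyWeight α t Q.degree * ‖MvPowerSeries.coeff Q f‖ ≤ M :=
    (Finset.single_le_sum (f := fun Q : Fin n →₀ ℕ =>
      gevreyWeight α t Q.degree * ‖MvPowerSeries.coeff Q f‖)
      (fun _ _ => mul_nonneg (gevreyWeight_pos ht _).le (norm_nonneg _))
      (mem_degreeLE.2 le_rfl)).trans (hf Q.degree)
  rw [← le_div_iff₀' (gevreyWeight_pos ht _)] at h1
  refine h1.trans (le_of_eq ?_)
  rw [gevreyWeight, inv_pow]
  field_simp

theorem poincareDulacHoldsInGevrey_of_relativeDenominatorBound {𝕜 : Type*} [RCLike 𝕜] {n : ℕ}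
    {lam : Fin n → 𝕜} {α : ℝ} (hα : 0 ≤ α) (h : RelativeDenominatorBound lam α) :
    PoincareDulacHoldsInGevrey lam α := by
  obtain ⟨C, hC, K, hK⟩ := h
  intro R hRa hR0 hR1
  have hcomp : ∀ j, AnalyticAt 𝕜 (fun x => R x j) 0 := fun j => analyticAt_pi_iff.1 hRa j
  have hder : ∀ j, fderiv 𝕜 (fun x => R x j) 0 = 0 := by
    intro j
    rw [fderiv_apply hRa.differentiableAt, hR1, ContinuousLinearMap.comp_zero]
  have hord : HasOrderGETwo (fun j => taylorAtZero (fun x => R x j)) := fun j Q hQ =>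
    coeff_taylorAtZero_of_degree_le_one (by rw [hR0]; rfl) (hder j) hQ
  obtain ⟨F, N, hF, hN, hres, heq⟩ := exists_formal_normalForm lam hord
  refine ⟨F, N, hF, fun j => ?_, hN, hres, conjugates_of_coeff_eq hF heq⟩
  choose A B hA hB hAB using fun j => norm_coeff_taylorAtZero_le (hcomp j)
  -- `K + 1` instead of `K` makes `|Q|` positive, so the lower bound is nonzero and excludes
  -- resonances.
  have hden : ∀ Q : Fin n →₀ ℕ, K + 1 ≤ Q.degree →
      0 < C * (Q.degree : ℝ) ^ (1 - α) := fun Q hQ => by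
    have : (0 : ℝ) < Q.degree := by exact_mod_cast (by omega : 0 < Q.degree)
    positivity
  have hNK : ∀ j Q, K + 1 ≤ Q.degree → MvPowerSeries.coeff Q (N j) = 0 := by
    intro j Q hQ
    by_contra hne
    have h1 := hK Q (by omega) j
    rw [hres j Q hne, sub_self, norm_zero] at h1
    exact absurd h1 (not_le.2 (hden Q hQ))
  have hAB' : ∀ k P, ‖MvPowerSeries.coeff P (taylorAtZero (fun x => R x k))‖ ≤
      (∑ j, A j) * (∑ j, B j) ^ P.degree := by
    intro k P
    refine (hAB k P).trans ?_
    have h1 := Finset.single_le_sum (fun i _ => (hA i).le) (Finset.mem_univ k)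
    have h2 := Finset.single_le_sum (fun i _ => (hB i).le) (Finset.mem_univ k)
    have h3 := (hB k).le
    have h4 : 0 ≤ ∑ j, A j := Finset.sum_nonneg fun i _ => (hA i).le
    gcongr
  obtain ⟨t, ht, hb⟩ := exists_weightedNorm_le hα
    (Finset.sum_pos (fun i _ => hA i) ⟨j, Finset.mem_univ j⟩)
    (Finset.sum_pos (fun i _ => hB i) ⟨j, Finset.mem_univ j⟩) hC hord hF hN hAB' hNK
    (fun k Q hQ => by
      rw [← heq k Q, hNK k Q hQ, add_zero, norm_mul, norm_sub_rev]
      exact mul_le_mul_of_nonneg_right (hK Q (by omega) k) (norm_nonneg _))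
  exact isGevrey_of_weightedNorm_le ht ht fun m => hb m j

theorem SiegelCondition.relativeDenominatorBound {𝕜 : Type*} [RCLike 𝕜] {n : ℕ}
    {lam : Fin n → 𝕜} {τ : ℝ} (h : SiegelCondition lam τ) :
    RelativeDenominatorBound lam (1 + τ) := by
  obtain ⟨C, hC, hS⟩ := h
  refine ⟨C, hC, 2, fun Q hQ j => ?_⟩
  rw [show 1 - (1 + τ) = -τ by ring, Real.rpow_neg (by positivity), ← div_eq_mul_inv, norm_sub_rev]
  exact (hS Q hQ j).2

theorem theorem5p2 {𝕜 : Type*} [RCLike 𝕜] {n : ℕ} (lam : Fin n → 𝕜) :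
    (∀ α : ℝ, 0 < α → RelativeDenominatorBound lam α → PoincareDulacHoldsInGevrey lam α) ∧
    (∀ τ : ℝ, 0 < τ → SiegelCondition lam τ → PoincareDulacHoldsInGevrey lam (1 + τ)) :=
  ⟨fun _ hα h => poincareDulacHoldsInGevrey_of_relativeDenominatorBound hα.le h,
    fun _ hτ h => poincareDulacHoldsInGevrey_of_relativeDenominatorBound (by linarith)
      h.relativeDenominatorBound⟩
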